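/- Rings are associative but not necessarily unital. For a subring $S$ of a ring $R$, the ring extension $R/S$ is called separable if the multiplication map $\mu : R \otimes_S R \to R$, $\mu(r \otimes r') = rr'$, admits a section in the category of $R$-bimodules, that is, if there is an $R$-bimodule homomorphism $\delta : R \to R \otimes_S R$ with $\mu \circ \delta = \mathrm{id}_R$. Let $\Gamma$ be a connected groupoid (a small category, all of whose morphisms are isomorphisms, with $\Gamma(e,f) \neq \emptyset$ for all objects $e,f$), with set of objects $\Gamma_0$; the domain and range of a morphism $\sigma$ are denoted by $d(\sigma)$ and $r(\sigma)$. Let $R$ be a ring that is strongly graded by $\Gamma$, that is, $R = \bigoplus_{\sigma \in \Gamma} R_\sigma$ for additive subgroups $R_\sigma$, indexed by the morphisms of $\Gamma$, such that for all morphisms $\sigma,\tau$ one has $R_\sigma R_\tau = R_{\sigma\tau}$ (finite sums of products) if $d(\sigma) = r(\tau)$, and $R_\sigma R_\tau = \{0\}$ otherwise. Suppose that the grading is object unital: for each $e \in \Gamma_0$ (identified with its identity morphism) the ring $R_e$ has a multiplicative identity $1_e$, and $1_{r(\sigma)} x = x = x 1_{d(\sigma)}$ for every morphism $\sigma$ and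 every $x \in R_\sigma$. Let $\Delta$ be a wide subgroupoid of $\Gamma$, i.e. a subgroupoid with the same objects as $\Gamma$. For a set $X$ of morphisms put $R_X := \bigoplus_{\sigma \in X} R_\sigma$, and for $e \in \Gamma_0$ let $\Gamma(e)$ and $\Delta(e)$ denote the groups of morphisms $e \to e$ in $\Gamma$ and in $\Delta$. If there is an object $e \in \Gamma_0$ such that the ring extension $R_{\Gamma(e)}/R_{\Delta(e)}$ is separable, then the ring extension $R/R_\Delta$ is separable. -/

import Mathlib

open CategoryTheory TensorProduct

universe v u w

/-! ### Separable extensions of (not necessarily unital) rings -/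

section Separable

variable {R : Type w} [NonUnitalRing R]

/-- The additive subgroup of `R ⊗[ℤ] R` generated by the elements
`(x * s) ⊗ y - x ⊗ (s * y)` with `x y : R` and `s ∈ S`. -/
def balancingSubgroup (S : NonUnitalSubring R) : AddSubgroup (R ⊗[ℤ] R) :=
  AddSubgroup.closure
    {t | ∃ x : R, ∃ s ∈ S, ∃ y : R, t = (x * s) ⊗ₜ[ℤ] y - x ⊗ₜ[ℤ] (s * y)}

/-- The tensor product `R ⊗_S R` of a ring `R` with itself over a subring `S`:
the biadditive tensor product modulo the `S`-balancing relations. -/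
abbrev BalancedTensor (S : NonUnitalSubring R) : Type _ :=
  (R ⊗[ℤ] R) ⧸ balancingSubgroup S

namespace BalancedTensor

/-- The left action of `a` on `R ⊗_S R`, given by `a (x ⊗ y) = (a x) ⊗ y`. -/
def leftAct (S : NonUnitalSubring R) (a : R) : BalancedTensor S →+ BalancedTensor S :=
  QuotientAddGroup.map (balancingSubgroup S) (balancingSubgroup S)
    (TensorProduct.map (LinearMap.mulLeft ℤ a) LinearMap.id).toAddMonoidHom (by
      refine (AddSubgroup.closure_le _).2 ?_
      rintro _ ⟨x, s, hs, y, rfl⟩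
      refine AddSubgroup.subset_closure ⟨a * x, s, hs, y, ?_⟩
      rw [map_sub]
      simp [mul_assoc])

/-- The right action of `a` on `R ⊗_S R`, given by `(x ⊗ y) a = x ⊗ (y a)`. -/
def rightAct (S : NonUnitalSubring R) (a : R) : BalancedTensor S →+ BalancedTensor S :=
  QuotientAddGroup.map (balancingSubgroup S) (balancingSubgroup S)
    (TensorProduct.map LinearMap.id (LinearMap.mulRight ℤ a)).toAddMonoidHom (by
      refine (AddSubgroup.closure_le _).2 ?_
      rintro _ ⟨x, s, hs, y, rfl⟩
      refine AddSubgroup.subset_closure ⟨x, s, hs, y * a, ?_⟩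
      rw [map_sub]
      simp [mul_assoc])

/-- The multiplication map `R ⊗_S R → R`, given by `x ⊗ y ↦ x y`. -/
def mulMap (S : NonUnitalSubring R) : BalancedTensor S →+ R :=
  QuotientAddGroup.lift (balancingSubgroup S) (LinearMap.mul' ℤ R).toAddMonoidHom (by
    refine (AddSubgroup.closure_le _).2 ?_
    rintro _ ⟨x, s, hs, y, rfl⟩
    change (LinearMap.mul' ℤ R).toAddMonoidHom _ = 0
    rw [map_sub]
    simp [mul_assoc])

end BalancedTensor

/-- The ring extension `R / S` is separable: the multiplication map `R ⊗_S R → R` has a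
section which is a homomorphism of `R`-bimodules. -/
def IsSeparableExtension (S : NonUnitalSubring R) : Prop :=
  ∃ δ : R →+ BalancedTensor S,
    (∀ a x : R, δ (a * x) = BalancedTensor.leftAct S a (δ x)) ∧
    (∀ a x : R, δ (x * a) = BalancedTensor.rightAct S a (δ x)) ∧
    ∀ x : R, BalancedTensor.mulMap S (δ x) = x

end Separable

/-! ### Rings graded by groupoids -/

/-- A grading of the ring `R` by the groupoid `Γ`. The composite `τσ` (first `σ`, then `τ`)
of `σ : a ⟶ b` and `τ : b ⟶ c` is written `σ ≫ τ`. -/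
structure GroupoidGrading (Γ : Type u) [Groupoid.{v} Γ] (R : Type w) [NonUnitalRing R] where
  /-- The homogeneous component `R_σ`. -/
  component : ∀ {a b : Γ}, (a ⟶ b) → AddSubgroup R
  /-- `R` is the internal direct sum of the `R_σ`, with `σ` ranging over all morphisms. -/
  isInternal : open Classical in
    DirectSum.IsInternal (fun σ : Quiver.Total Γ => component σ.hom)
  /-- `R_τ R_σ ⊆ R_{τσ}` if `τσ` is defined. -/
  mul_mem : ∀ {a b c : Γ} (τ : b ⟶ c) (σ : a ⟶ b) {x y : R},
    x ∈ component τ → y ∈ component σ → x * y ∈ component (σ ≫ τ)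
  /-- `R_τ R_σ = 0` if `τσ` is not defined. -/
  mul_eq_zero : ∀ {a b c d : Γ} (τ : c ⟶ d) (σ : a ⟶ b), c ≠ b → ∀ {x y : R},
    x ∈ component τ → y ∈ component σ → x * y = 0

namespace GroupoidGrading

variable {Γ : Type u} [Groupoid.{v} Γ] {R : Type w} [NonUnitalRing R]

/-- The grading is strong: `R_τ R_σ = R_{τσ}` whenever `τσ` is defined, where `R_τ R_σ` is the
set of finite sums of products. -/
def IsStrong (𝒜 : GroupoidGrading Γ R) : Prop :=
  ∀ {a b c : Γ} (τ : b ⟶ c) (σ : a ⟶ b),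
    AddSubgroup.closure {z : R | ∃ x ∈ 𝒜.component τ, ∃ y ∈ 𝒜.component σ, z = x * y} =
      𝒜.component (σ ≫ τ)

/-- The grading is object unital: every `R_e` has a multiplicative unit `1_e`, and
`1_{r(σ)} x = x = x 1_{d(σ)}` for every `x ∈ R_σ`. -/
def IsObjectUnital (𝒜 : GroupoidGrading Γ R) : Prop :=
  ∃ u : Γ → R, (∀ e : Γ, u e ∈ 𝒜.component (𝟙 e)) ∧
    ∀ {a b : Γ} (σ : a ⟶ b), ∀ x ∈ 𝒜.component σ, u b * x = x ∧ x * u a = x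

/-- The subring `R_D`, that is, the sum of the components `R_σ` with `σ` in the
subgroupoid `D`. -/
def subring (𝒜 : GroupoidGrading Γ R) (D : Subgroupoid Γ) : NonUnitalSubring R :=
  { AddSubgroup.closure
      {x : R | ∃ (a b : Γ) (σ : a ⟶ b), σ ∈ D.arrows a b ∧ x ∈ 𝒜.component σ} with
    mul_mem' := by
      intro x y hx hy
      change x ∈ AddSubgroup.closure _ at hx
      change y ∈ AddSubgroup.closure _ at hy
      change x * y ∈ AddSubgroup.closure _
      induction hx, hy using AddSubgroup.closure_induction₂ with
      | mem x y hx hy =>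
        obtain ⟨c, d, τ, hτ, hx⟩ := hx
        obtain ⟨a, b, σ, hσ, hy⟩ := hy
        by_cases h : c = b
        · subst h
          exact AddSubgroup.subset_closure
            ⟨a, d, σ ≫ τ, D.mul hσ hτ, 𝒜.mul_mem τ σ hx hy⟩
        · rw [𝒜.mul_eq_zero τ σ h hx hy]
          exact zero_mem _
      | zero_left x hx => simpa only [zero_mul] using zero_mem _
      | zero_right x hx => simpa only [mul_zero] using zero_mem _
      | add_left x y z hx hy hz h1 h2 => simpa only [add_mul] using add_mem h1 h2
      | add_right y z x hy hz hx h1 h2 => simpa only [mul_add] using add_mem h1 h2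
      | neg_left x y hx hy h => simpa only [neg_mul] using neg_mem h
      | neg_right x y hx hy h => simpa only [mul_neg] using neg_mem h }

end GroupoidGrading

/-- The isotropy group `D(e)` of the subgroupoid `D` at `e`, regarded as a subgroupoid of `Γ`:
its morphisms are those `e ⟶ e` that lie in `D`. -/
def isotropyAt {Γ : Type u} [Groupoid.{v} Γ] (D : Subgroupoid Γ) (e : Γ) : Subgroupoid Γ where
  arrows a b := {σ | a = e ∧ b = e ∧ σ ∈ D.arrows a b}
  inv := by
    rintro a b σ ⟨ha, hb, hσ⟩
    exact ⟨hb, ha, D.inv hσ⟩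
  mul := by
    rintro a b c σ ⟨ha, hb, hσ⟩ τ ⟨_, hc, hτ⟩
    exact ⟨ha, hc, D.mul hσ hτ⟩

/-! A bimodule section is encoded by local Casimir elements `ω f` in `R ⊗_S R`, with `S = R_Δ`,
satisfying `μ(ω f) = 1_f`, `ω f · 1_f = ω f` and `x · ω f = ω g · x` for `x` of degree `f ⟶ g`; the
section is then `x ↦ x · ω f` on elements of domain `f` (`isSeparableExtension_of_family`). At `e`,
the image `ω` of `δ(1_e)` commutes with `R_{Γ(e)}` and multiplies to `1_e`. By connectedness there
is some `σ : e ⟶ f`, and strongness gives `1_f = ∑ aᵢ bᵢ` with `aᵢ` of degree `σ` and `bᵢ` of degree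
`σ⁻¹`; put `ω f = ∑ aᵢ ω bᵢ`. If likewise `1_g = ∑ a'ⱼ b'ⱼ`, then each `b'ⱼ x aᵢ` has degree in
`Γ(e)` and so passes through `ω`, which gives `x · ω f = ∑ a'ⱼ (b'ⱼ x aᵢ) ω bᵢ = ∑ a'ⱼ ω (b'ⱼ x aᵢ)
bᵢ = ω g · x` (`leftAct_eq_rightAct_of_mem_transport`). -/

namespace BalancedTensor

/-! ### Bimodule calculus in `R ⊗_S R`. -/

variable {R : Type w} [NonUnitalRing R] (S : NonUnitalSubring R)

/-- The class of `x ⊗ y` in `R ⊗_S R`. -/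
def tmul (x y : R) : BalancedTensor S :=
  QuotientAddGroup.mk' (balancingSubgroup S) (x ⊗ₜ[ℤ] y)

variable {S}

theorem induction_tmul {p : BalancedTensor S → Prop} (t : BalancedTensor S)
    (zero : p 0) (tmul : ∀ x y, p (tmul S x y))
    (add : ∀ s t, p s → p t → p (s + t)) : p t := by
  obtain ⟨t, rfl⟩ := QuotientAddGroup.mk'_surjective (balancingSubgroup S) t
  induction t using TensorProduct.induction_on with
  | zero => rw [map_zero]; exact zero
  | tmul x y => exact tmul x y
  | add s t hs ht => rw [map_add]; exact add _ _ hs ht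

@[simp]
theorem leftAct_tmul (a x y : R) : leftAct S a (tmul S x y) = tmul S (a * x) y := rfl

@[simp]
theorem rightAct_tmul (a x y : R) : rightAct S a (tmul S x y) = tmul S x (y * a) := rfl

@[simp]
theorem mulMap_tmul (x y : R) : mulMap S (tmul S x y) = x * y := rfl

theorem tmul_add (x y z : R) : tmul S x (y + z) = tmul S x y + tmul S x z := by
  simp [tmul, TensorProduct.tmul_add]

theorem add_tmul (x y z : R) : tmul S (x + y) z = tmul S x z + tmul S y z := by
  simp [tmul, TensorProduct.add_tmul]

theorem leftAct_add (a b : R) (t : BalancedTensor S) :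
    leftAct S (a + b) t = leftAct S a t + leftAct S b t := by
  induction t using induction_tmul with
  | zero => simp
  | tmul x y => simp [add_mul, add_tmul]
  | add s t hs ht => simp only [map_add, hs, ht]; abel

theorem rightAct_add (a b : R) (t : BalancedTensor S) :
    rightAct S (a + b) t = rightAct S a t + rightAct S b t := by
  induction t using induction_tmul with
  | zero => simp
  | tmul x y => simp [mul_add, tmul_add]
  | add s t hs ht => simp only [map_add, hs, ht]; abel

variable (S) in
/-- The left action on `R ⊗_S R` as a biadditive map. -/
def leftActHom : R →+ BalancedTensor S →+ BalancedTensor S :=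
  AddMonoidHom.mk' (leftAct S) fun a b => AddMonoidHom.ext (leftAct_add a b)

variable (S) in
/-- The right action on `R ⊗_S R` as a biadditive map. -/
def rightActHom : R →+ BalancedTensor S →+ BalancedTensor S :=
  AddMonoidHom.mk' (rightAct S) fun a b => AddMonoidHom.ext (rightAct_add a b)

@[simp]
theorem leftAct_zero (t : BalancedTensor S) : leftAct S 0 t = 0 :=
  DFunLike.congr_fun (map_zero (leftActHom S)) t

@[simp]
theorem rightAct_zero (t : BalancedTensor S) : rightAct S 0 t = 0 :=
  DFunLike.congr_fun (map_zero (rightActHom S)) t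

theorem leftAct_neg (a : R) (t : BalancedTensor S) : leftAct S (-a) t = -leftAct S a t :=
  DFunLike.congr_fun (map_neg (leftActHom S) a) t

theorem rightAct_neg (a : R) (t : BalancedTensor S) : rightAct S (-a) t = -rightAct S a t :=
  DFunLike.congr_fun (map_neg (rightActHom S) a) t

theorem leftAct_mul (a b : R) (t : BalancedTensor S) :
    leftAct S (a * b) t = leftAct S a (leftAct S b t) := by
  induction t using induction_tmul with
  | zero => simp
  | tmul x y => simp [mul_assoc]
  | add s t hs ht => simp only [map_add, hs, ht]

theorem rightAct_mul (a b : R) (t : BalancedTensor S) :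
    rightAct S (a * b) t = rightAct S b (rightAct S a t) := by
  induction t using induction_tmul with
  | zero => simp
  | tmul x y => simp [mul_assoc]
  | add s t hs ht => simp only [map_add, hs, ht]

theorem leftAct_rightAct_comm (a b : R) (t : BalancedTensor S) :
    leftAct S a (rightAct S b t) = rightAct S b (leftAct S a t) := by
  induction t using induction_tmul with
  | zero => simp
  | tmul x y => simp
  | add s t hs ht => simp only [map_add, hs, ht]

theorem mulMap_leftAct (a : R) (t : BalancedTensor S) :
    mulMap S (leftAct S a t) = a * mulMap S t := by
  induction t using induction_tmul with
  | zero => simp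
  | tmul x y => simp [mul_assoc]
  | add s t hs ht => simp only [map_add, hs, ht, mul_add]

theorem mulMap_rightAct (a : R) (t : BalancedTensor S) :
    mulMap S (rightAct S a t) = mulMap S t * a := by
  induction t using induction_tmul with
  | zero => simp
  | tmul x y => simp [mul_assoc]
  | add s t hs ht => simp only [map_add, hs, ht, add_mul]

/-! ### Functoriality of the balanced tensor product in the ring extension. -/

section Inclusion

variable {A : NonUnitalSubring R} {S₀ : NonUnitalSubring A} (hS : ∀ s ∈ S₀, (s : R) ∈ S)

/-- The map `A ⊗_{S₀} A → R ⊗_S R` induced by the inclusions `A ⊆ R` and `S₀ ⊆ S`. -/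
def inclusion : BalancedTensor S₀ →+ BalancedTensor S :=
  QuotientAddGroup.map (balancingSubgroup S₀) (balancingSubgroup S)
    (TensorProduct.map (NonUnitalSubringClass.subtype A : A →+ R).toIntLinearMap
      (NonUnitalSubringClass.subtype A : A →+ R).toIntLinearMap).toAddMonoidHom (by
      refine (AddSubgroup.closure_le _).2 ?_
      rintro _ ⟨x, s, hs, y, rfl⟩
      refine AddSubgroup.subset_closure ⟨x, s, hS s hs, y, ?_⟩
      rw [map_sub]
      rfl)

theorem inclusion_tmul (x y : A) :
    inclusion hS (tmul S₀ x y) = tmul S (x : R) (y : R) := rfl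

theorem inclusion_leftAct (a : A) (t : BalancedTensor S₀) :
    inclusion hS (leftAct S₀ a t) = leftAct S (a : R) (inclusion hS t) := by
  induction t using induction_tmul with
  | zero => simp
  | tmul x y => simp [inclusion_tmul]
  | add s t hs ht => simp only [map_add, hs, ht]

theorem inclusion_rightAct (a : A) (t : BalancedTensor S₀) :
    inclusion hS (rightAct S₀ a t) = rightAct S (a : R) (inclusion hS t) := by
  induction t using induction_tmul with
  | zero => simp
  | tmul x y => simp [inclusion_tmul]
  | add s t hs ht => simp only [map_add, hs, ht]

theorem mulMap_inclusion (t : BalancedTensor S₀) :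
    mulMap S (inclusion hS t) = (mulMap S₀ t : R) := by
  induction t using induction_tmul with
  | zero => simp
  | tmul x y => simp [inclusion_tmul]
  | add s t hs ht => simp only [map_add, hs, ht]; rfl

end Inclusion

end BalancedTensor

/-! ### Separability from local Casimir elements. -/

namespace GroupoidGrading

open BalancedTensor

variable {Γ : Type u} [Groupoid.{v} Γ] {R : Type w} [NonUnitalRing R]
  (𝒜 : GroupoidGrading Γ R)

theorem induction_homogeneous {p : R → Prop} (x : R) (zero : p 0)
    (mem : ∀ {a b : Γ} (σ : a ⟶ b), ∀ x ∈ 𝒜.component σ, p x)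
    (add : ∀ x y, p x → p y → p (x + y)) : p x := by
  classical
  obtain ⟨t, rfl⟩ := 𝒜.isInternal.2 x
  induction t using DirectSum.induction_on with
  | zero => rw [map_zero]; exact zero
  | of σ x => rw [DirectSum.coeAddMonoidHom_of]; exact mem σ.hom _ x.2
  | add s t hs ht => rw [map_add]; exact add _ _ hs ht

/-- Additive maps on the homogeneous components glue to an additive map on the whole ring. -/
theorem exists_addMonoidHom {M : Type*} [AddCommGroup M] (f : Γ → R →+ M) :
    ∃ δ : R →+ M, ∀ {a b : Γ} (σ : a ⟶ b), ∀ x ∈ 𝒜.component σ, δ x = f a x := by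
  classical
  let E := AddEquiv.ofBijective _ 𝒜.isInternal
  let F := DirectSum.toAddMonoid fun σ : Quiver.Total Γ =>
    (f σ.left).comp (𝒜.component σ.hom).subtype
  refine ⟨F.comp E.symm.toAddMonoidHom, fun {a b} σ x hx => ?_⟩
  let τ : Quiver.Total Γ := ⟨a, b, σ⟩
  have hE : E (DirectSum.of (fun σ : Quiver.Total Γ => 𝒜.component σ.hom) τ ⟨x, hx⟩) = x :=
    DirectSum.coeAddMonoidHom_of _ τ ⟨x, hx⟩
  change F (E.symm x) = f a x
  rw [E.symm_apply_eq.2 hE.symm]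
  exact DirectSum.toAddMonoid_of _ τ _

theorem mem_subring {D : Subgroupoid Γ} {a b : Γ} {σ : a ⟶ b} (hσ : σ ∈ D.arrows a b)
    {x : R} (hx : x ∈ 𝒜.component σ) : x ∈ 𝒜.subring D :=
  AddSubgroup.subset_closure ⟨a, b, σ, hσ, hx⟩

theorem subring_mono {D D' : Subgroupoid Γ} (h : ∀ a b, D.arrows a b ⊆ D'.arrows a b) : 𝒜.subring D ≤ 𝒜.subring D' :=
  AddSubgroup.closure_mono fun _ ⟨a, b, σ, hσ, hx⟩ => ⟨a, b, σ, h a b hσ, hx⟩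

/-- A family of local separability idempotents yields separability. -/
theorem isSeparableExtension_of_family (S : NonUnitalSubring R) (u : Γ → R)
    (hmem : ∀ e, u e ∈ 𝒜.component (𝟙 e))
    (hu : ∀ {a b : Γ} (σ : a ⟶ b), ∀ x ∈ 𝒜.component σ, u b * x = x ∧ x * u a = x)
    (ω : Γ → BalancedTensor S) (hmul : ∀ f, mulMap S (ω f) = u f)
    (hright : ∀ f, rightAct S (u f) (ω f) = ω f)
    (hcomm : ∀ {f g : Γ} (σ : f ⟶ g), ∀ x ∈ 𝒜.component σ,
      leftAct S x (ω f) = rightAct S x (ω g)) :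
    IsSeparableExtension S := by
  -- The section is `x ↦ x · ω a` for `x` homogeneous with domain `a`.
  obtain ⟨δ, hδ⟩ := 𝒜.exists_addMonoidHom fun f => (leftActHom S).flip (ω f)
  replace hδ : ∀ {a b : Γ} (σ : a ⟶ b), ∀ x ∈ 𝒜.component σ, δ x = leftAct S x (ω a) := hδ
  refine ⟨δ, fun a x => ?_, fun a x => ?_, fun x => ?_⟩
  · induction a using 𝒜.induction_homogeneous with
    | zero => simp
    | add a b ha hb => rw [add_mul, map_add, ha, hb, leftAct_add]
    | mem τ a ha =>
      induction x using 𝒜.induction_homogeneous with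
      | zero => simp
      | add x y hx hy => rw [mul_add, map_add, hx, hy, map_add, map_add]
      | mem σ x hx =>
        rw [hδ σ x hx, ← leftAct_mul]
        rename_i c d b b'
        by_cases h : c = b'
        · subst h
          exact hδ _ _ (𝒜.mul_mem τ σ ha hx)
        · rw [𝒜.mul_eq_zero τ σ h ha hx, map_zero, leftAct_zero]
  · induction a using 𝒜.induction_homogeneous with
    | zero => simp
    | add a b ha hb => rw [mul_add, map_add, ha, hb, rightAct_add]
    | mem σ a ha =>
      induction x using 𝒜.induction_homogeneous with
      | zero => simp
      | add x y hx hy => rw [add_mul, map_add, hx, hy, map_add, map_add]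
      | mem τ x hx =>
        rename_i b b' c d
        rw [hδ τ x hx]
        by_cases h : c = b'
        · subst h
          rw [hδ _ _ (𝒜.mul_mem τ σ hx ha), leftAct_mul, hcomm σ a ha, leftAct_rightAct_comm]
        -- Non-composable degrees: since `ω c = ω c · u c`, acting by `a` on the right produces the
        -- factor `u c * a = 0`.
        · rw [𝒜.mul_eq_zero τ σ h hx ha, map_zero, ← hright c, ← leftAct_rightAct_comm,
            ← rightAct_mul, 𝒜.mul_eq_zero (𝟙 c) σ h (hmem c) ha, rightAct_zero, map_zero]
  · induction x using 𝒜.induction_homogeneous with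
    | zero => simp
    | add x y hx hy => rw [map_add, map_add, hx, hy]
    | mem σ x hx => rw [hδ σ x hx, mulMap_leftAct, hmul, (hu σ x hx).2]

/-! ### Conjugating a Casimir element from `e` to other objects. -/

section Transport

variable {S : NonUnitalSubring R} {e : Γ} (ω : BalancedTensor S)

/-- The additive group of all pairs `(∑ aᵢ bᵢ, ∑ aᵢ ω bᵢ)` with `aᵢ` of degree `σ` and
`bᵢ` of degree `σ⁻¹`. -/
def transport {f : Γ} (σ : e ⟶ f) : AddSubgroup (R × BalancedTensor S) :=
  AddSubgroup.closure {p | ∃ a ∈ 𝒜.component σ, ∃ b ∈ 𝒜.component (Groupoid.inv σ),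
    p = (a * b, leftAct S a (rightAct S b ω))}

/-- Strongness makes `R_σ R_{σ⁻¹}` all of `R_{𝟙 f}`. The element `t` depends on the decomposition of
`z`; working with pairs avoids both naming the sums and any question of well-definedness. -/
theorem exists_mem_transport (hstrong : 𝒜.IsStrong) {f : Γ} (σ : e ⟶ f) {z : R}
    (hz : z ∈ 𝒜.component (𝟙 f)) : ∃ t, (z, t) ∈ 𝒜.transport ω σ := by
  rw [← Groupoid.inv_comp σ, ← hstrong σ (Groupoid.inv σ)] at hz
  induction hz using AddSubgroup.closure_induction with
  | mem z hz =>
    obtain ⟨a, ha, b, hb, rfl⟩ := hz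
    exact ⟨_, AddSubgroup.subset_closure ⟨a, ha, b, hb, rfl⟩⟩
  | zero => exact ⟨0, zero_mem _⟩
  | add x y _ _ hx hy =>
    obtain ⟨s, hs⟩ := hx
    obtain ⟨t, ht⟩ := hy
    exact ⟨s + t, add_mem hs ht⟩
  | neg x _ hx =>
    obtain ⟨s, hs⟩ := hx
    exact ⟨-s, neg_mem hs⟩

variable {ω}

theorem mulMap_of_mem_transport (hω : ∀ {f : Γ} (σ : e ⟶ f), ∀ x ∈ 𝒜.component σ,
      x * mulMap S ω = x) {f : Γ} {σ : e ⟶ f} {p : R × BalancedTensor S}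
    (hp : p ∈ 𝒜.transport ω σ) : mulMap S p.2 = p.1 := by
  induction hp using AddSubgroup.closure_induction with
  | mem p hp =>
    obtain ⟨a, ha, b, hb, rfl⟩ := hp
    simp only [mulMap_leftAct, mulMap_rightAct, ← mul_assoc, hω σ a ha]
  | zero => simp
  | add p q _ _ hp hq => simp [hp, hq]
  | neg p _ hp => simp [hp]

/-- The rightmost factors `bᵢ` have degree `σ⁻¹` and absorb `c`; the intended `c` is `1_f`. -/
theorem rightAct_of_mem_transport {f : Γ} {c : R} (σ : e ⟶ f)
    (hc : ∀ x ∈ 𝒜.component (Groupoid.inv σ), x * c = x) {p : R × BalancedTensor S}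
    (hp : p ∈ 𝒜.transport ω σ) : rightAct S c p.2 = p.2 := by
  induction hp using AddSubgroup.closure_induction with
  | mem p hp =>
    obtain ⟨a, ha, b, hb, rfl⟩ := hp
    simp only [← leftAct_rightAct_comm, ← rightAct_mul, hc b hb]
  | zero => simp
  | add p q _ _ hp hq => simp [hp, hq]
  | neg p _ hp => simp [hp]

/-- Both sides are biadditive in `p` and `q`, so generators suffice: there `b' x a` is a loop at `e`
and moves across `ω`. When the first entries of `p` and `q` are `1_f` and `1_g`, this is the Casimir
identity for `x`. -/
theorem leftAct_eq_rightAct_of_mem_transport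
    (hω : ∀ (σ : e ⟶ e), ∀ c ∈ 𝒜.component σ, leftAct S c ω = rightAct S c ω)
    {f g : Γ} {σ : e ⟶ f} {τ : e ⟶ g} {p q : R × BalancedTensor S}
    (hp : p ∈ 𝒜.transport ω σ) (hq : q ∈ 𝒜.transport ω τ)
    {ρ : f ⟶ g} {x : R} (hx : x ∈ 𝒜.component ρ) :
    leftAct S (q.1 * x) p.2 = rightAct S (x * p.1) q.2 := by
  induction hp using AddSubgroup.closure_induction with
  | mem p hp =>
    obtain ⟨a, ha, b, hb, rfl⟩ := hp
    induction hq using AddSubgroup.closure_induction with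
    | mem q hq =>
      obtain ⟨a', ha', b', hb', rfl⟩ := hq
      have hc := hω _ _ (𝒜.mul_mem _ _ (𝒜.mul_mem _ _ hb' hx) ha)
      simp only [leftAct_mul, rightAct_mul, leftAct_rightAct_comm] at hc ⊢
      rw [hc]
      simp only [leftAct_rightAct_comm]
    | zero => simp
    | add q q' _ _ h h' =>
      simp only [Prod.fst_add, Prod.snd_add, add_mul, leftAct_add, map_add, h, h']
    | neg q _ h => simp only [Prod.fst_neg, Prod.snd_neg, neg_mul, leftAct_neg, map_neg, h]
  | zero => simp
  | add p p' _ _ h h' => simp [mul_add, rightAct_add, h, h']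
  | neg p _ h => simp [rightAct_neg, h]

end Transport

end GroupoidGrading

open BalancedTensor in
theorem mainTheorem4 {Γ : Type u} [Groupoid.{v} Γ] (hΓ : ∀ e f : Γ, Nonempty (e ⟶ f))
    {R : Type w} [NonUnitalRing R] (𝒜 : GroupoidGrading Γ R)
    (hunital : 𝒜.IsObjectUnital) (hstrong : 𝒜.IsStrong)
    (Δ : Subgroupoid Γ) (hΔ : Δ.IsWide)
    (h : ∃ e : Γ, IsSeparableExtension
      ((𝒜.subring (isotropyAt Δ e)).comap
        (NonUnitalSubringClass.subtype (𝒜.subring (isotropyAt ⊤ e))))) :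
    IsSeparableExtension (𝒜.subring Δ) := by
  obtain ⟨u, hmem, hu⟩ := hunital
  obtain ⟨e, δ, hδl, hδr, hδm⟩ := h
  have hS : ∀ s ∈ (𝒜.subring (isotropyAt Δ e)).comap
      (NonUnitalSubringClass.subtype (𝒜.subring (isotropyAt ⊤ e))), (s : R) ∈ 𝒜.subring Δ :=
    fun s hs => 𝒜.subring_mono (D := isotropyAt Δ e) (fun _ _ _ hσ => hσ.2.2) hs
  have hA : ∀ (σ : e ⟶ e), ∀ c ∈ 𝒜.component σ, c ∈ 𝒜.subring (isotropyAt ⊤ e) :=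
    fun σ c hc => 𝒜.mem_subring (D := isotropyAt ⊤ e) (σ := σ) ⟨rfl, rfl, trivial⟩ hc
  let i : 𝒜.subring (isotropyAt ⊤ e) := ⟨u e, hA _ _ (hmem e)⟩
  let ω := inclusion hS (δ i)
  have hωm : mulMap (𝒜.subring Δ) ω = u e := by
    rw [mulMap_inclusion, hδm]
  have hωc : ∀ (σ : e ⟶ e), ∀ c ∈ 𝒜.component σ,
      leftAct (𝒜.subring Δ) c ω = rightAct (𝒜.subring Δ) c ω := by
    intro σ c hc
    let c' : 𝒜.subring (isotropyAt ⊤ e) := ⟨c, hA σ c hc⟩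
    -- Bilinearity of `δ` gives `c δ(1_e) = δ(c 1_e) = δ(1_e c) = δ(1_e) c`.
    have h : c' * i = i * c' := Subtype.ext ((hu σ c hc).2.trans (hu σ c hc).1.symm)
    rw [← inclusion_leftAct hS c', ← inclusion_rightAct hS c', ← hδl, ← hδr, h]
  have hσ : ∀ f : Γ, ∃ (σ : e ⟶ f) (t : _), (u f, t) ∈ 𝒜.transport ω σ := fun f =>
    ⟨(hΓ e f).some, 𝒜.exists_mem_transport ω hstrong _ (hmem f)⟩
  choose σ t ht using hσ
  refine 𝒜.isSeparableExtension_of_family _ u hmem hu t (fun f => ?_) (fun f => ?_) ?_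
  · exact 𝒜.mulMap_of_mem_transport (fun τ x hx => by rw [hωm, (hu τ x hx).2]) (ht f)
  · exact 𝒜.rightAct_of_mem_transport (σ f) (fun x hx => (hu _ x hx).2) (ht f)
  · intro f g ρ x hx
    have key := 𝒜.leftAct_eq_rightAct_of_mem_transport hωc (ht f) (ht g) hx
    -- The factors `u g * x` and `x * u f` in `key` both collapse to `x`.
    rwa [(hu ρ x hx).1, (hu ρ x hx).2] at key
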